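/- A dynamical system with double recursion is a tuple $\mathfrak A=(A,f,0,1)$ consisting of a finite set $A$, a function $f:A\times A\to A$ and elements $0,1\in A$. Its development is the function $a:\mathbb N\times\mathbb N\to A$ with $a(i,j)=1$ if $i=0$ or $j=0$, and $a(i,j)=f(a(i-1,j),a(i,j-1))$ if $i,j>0$. The system is called ultimately zero if there is $N\in\mathbb N$ such that $a(i,j)=0$ for all $i,j>0$ with $i+j>N$. Consider the dynamical systems $(\mathbb F_q,F,0,1)$ where $\mathbb F_q$ is a finite field, $F\in\mathbb F_q[x,y]$ is a polynomial, acting on $\mathbb F_q$ as the function $(x,y)\mapsto F(x,y)$, and $0,1$ are the zero and the one of $\mathbb F_q$. Such a system is given to an algorithm by a prime $p$, an irreducible polynomial $g\in\mathbb F_p[t]$ with $\mathbb F_q=\mathbb F_p[t]/(g)$, and a finite list of terms $a\,x^iy^j$ with sum $F$, where $g$ is given by its list of coefficients and each $a\in\mathbb F_q$ by the list of coefficients of a polynomial in $t$ that represents it. Then: 1. There is no algorithm that decides, for every such system, whether it is ultimately zero. 2. There is no algorithm that decides this for all those systems for which, simultaneously, $\mathbb F_q$ is a prime field $\mathbb F_p$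 and $F$ is a symmetric polynomial, $F(x,y)=F(y,x)$. -/

import Mathlib

universe u

/-- A dynamical system with double recursion `(A, f, 0, 1)`: a finite set `A`, a function
`f : A × A → A`, the white colour `0 ∈ A` (here `white`) and the start symbol `1 ∈ A`
(here `start`). -/
structure DoubleRecursionSystem where
  A : Type u
  finite : Finite A
  f : A → A → A
  white : A
  start : A

namespace DoubleRecursionSystem

/-- The development `a : ℕ × ℕ → A`: it is the start symbol if `i = 0` or `j = 0`, and
`a(i, j) = f(a(i-1, j), a(i, j-1))` if `i, j > 0`. -/
def development (S : DoubleRecursionSystem.{u}) : ℕ → ℕ → S.A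
  | 0, _ => S.start
  | _ + 1, 0 => S.start
  | i + 1, j + 1 => S.f (S.development i (j + 1)) (S.development (i + 1) j)
termination_by i j => (i, j)

/-- A system is ultimately zero if all but finitely many of the diagonals `i + j = n` of its
development are white, apart from the start symbols on the borders. -/
def UltimatelyZero (S : DoubleRecursionSystem.{u}) : Prop :=
  ∃ N : ℕ, ∀ i j : ℕ, 0 < i ∧ 0 < j ∧ i + j > N → S.development i j = S.white

end DoubleRecursionSystem

/-- The raw finite data given to an algorithm: a triple `(p, g, F)` where `p` is a number,
`g` is the list of the coefficients (constant term first) of a modulus, and `F` is a list of terms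
`(a, i, j)`, each standing for `a x ^ i y ^ j`; the coefficient `a` is itself given by the list of
its coordinates in the powers of the class of the variable modulo `g`. -/
abbrev RawCode : Type := ℕ × List ℕ × List (List ℕ × ℕ × ℕ)

namespace RawCode

/-- The polynomial `l₀ + l₁ t + l₂ t ^ 2 + …` over `ℤ/pℤ` with the given list of coefficients. -/
noncomputable def listPoly (p : ℕ) (l : List ℕ) : Polynomial (ZMod p) :=
  l.foldr (fun (a : ℕ) f => Polynomial.C (a : ZMod p) + Polynomial.X * f) 0

/-- The modulus `g ∈ 𝔽_p[t]`. -/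
noncomputable def modulus (c : RawCode) : Polynomial (ZMod c.1) := listPoly c.1 c.2.1

/-- The data describe a finite field `𝔽_p[t]/(g)`: `p` is prime and `g` is irreducible. -/
def IsValid (c : RawCode) : Prop := c.1.Prime ∧ Irreducible c.modulus

end RawCode

/-- Codes of the systems `(𝔽_q, F, 0, 1)`. -/
abbrev FieldSystemCode : Type := {c : RawCode // c.IsValid}

namespace FieldSystemCode

/-- The coded finite field `𝔽_q = 𝔽_p[t]/(g)`; up to isomorphism every finite field is of this
form. -/
abbrev K (c : FieldSystemCode) : Type := AdjoinRoot c.1.modulus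

theorem isField_K (c : FieldSystemCode) : IsField c.K := by
  have : Fact c.1.1.Prime := ⟨c.2.1⟩
  have : Fact (Irreducible c.1.modulus) := ⟨c.2.2⟩
  exact Field.toIsField (AdjoinRoot c.1.modulus)

theorem finite_K (c : FieldSystemCode) : Finite c.K := by
  have : Fact c.1.1.Prime := ⟨c.2.1⟩
  have : Module.Finite (ZMod c.1.1) (AdjoinRoot c.1.modulus) :=
    (AdjoinRoot.powerBasis c.2.2.ne_zero).finite
  exact Module.finite_of_finite (ZMod c.1.1)

/-- The coded polynomial `F ∈ 𝔽_q[x, y]`, with `x = X 0` and `y = X 1`. -/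
noncomputable def poly (c : FieldSystemCode) : MvPolynomial (Fin 2) c.K :=
  (c.1.2.2.map fun m =>
    MvPolynomial.C (AdjoinRoot.mk c.1.modulus (RawCode.listPoly c.1.1 m.1)) *
      MvPolynomial.X 0 ^ m.2.1 * MvPolynomial.X 1 ^ m.2.2).sum

/-- The system `(𝔽_q, F, 0, 1)`, where `0` and `1` are those of the field. -/
noncomputable def system (c : FieldSystemCode) : DoubleRecursionSystem where
  A := c.K
  finite := c.finite_K
  f := fun x y => MvPolynomial.eval ![x, y] c.poly
  white := 0
  start := 1

/-- The coded field is a prime field, that is, the number of its elements is prime. -/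
def IsPrimeField (c : FieldSystemCode) : Prop := (Nat.card c.K).Prime

end FieldSystemCode

/-- The question `P`, asked for the codes in the class `D`, is decidable: there is an algorithm (a
partial recursive function on raw codes) which halts on every code in `D` with the correct answer.
Nothing is required of it on other inputs. -/
def DecidableOn {α : Type*} [Primcodable α] {V : α → Prop} (D P : {a : α // V a} → Prop) : Prop :=
  ∃ alg : α →. Bool, Partrec alg ∧
    ∀ c : {a : α // V a}, D c → ∃ b ∈ alg c.1, (b = true ↔ P c)

/-!
The halting problem is reduced to the question for symmetric polynomials over prime fields, which
are among the systems of the first claim.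

If `f` is symmetric, then the development is symmetric about the diagonal, and it is determined by
the columns `w i k = a (i, i + k)`. Here `w (i + 1) (k + 1)` depends on `w i (k + 2)` and on
`w (i + 1) k`, and `w (i + 1) 0` depends on `w i 1`, which it receives from both sides. So a column
arises from the previous one in a single sweep by a finite transducer. If every colour carries the
number `i` modulo `3` of its column, then `f` can tell its arguments apart although it is symmetric,
unless they are the two mirror images at the diagonal, and then it has to start a new column. If
every colour also remembers the last symbols read, then the sweep sees the cells `k - 1`, `k` and
`k + 1` of the previous column when it writes cell `k`. It simulates one step of a Turing machine
whose tape is folded at the head: the head is always at the start of the column, and moving it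
shifts one half of the tape up and the other one down (`SimCell.rule`, `SimCell.IsConfig.next`).
A column has only finitely many nonwhite cells, and once the machine halts the columns die out;
otherwise every column starts with a nonwhite cell (`SimCell.eventually_white_iff`).

The machine is fixed (`Turing.TM0.exists_undecidable_halting`). Only its input varies: a block of
`m + 1` equal symbols, after two fixed ones. It is written on the first column by colours which
count up next to the start symbols on the border (`numberRule`); this makes the number of colours
depend on `m`, and a prime `p` is chosen above it. Lagrange interpolation turns the rule into a
symmetric polynomial over `ℤ/pℤ` whose list of terms is a primitive recursive function of `m`
(`primeFieldCode_eval`, `primrec_interpolationTerms`).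
-/

/-! ### A fixed Turing machine with an undecidable halting problem -/

namespace Turing

open StateTransition

/-- A `TM0` machine supported on a finite set of labels is equivalent, as far as halting is
concerned, to a machine whose type of labels is finite. -/
theorem TM0.exists_finite_labels {Γ Λ : Type} [Inhabited Γ] [Inhabited Λ] (M : TM0.Machine Γ Λ)
    {S : Set Λ} (hS : S.Finite) (ss : TM0.Supports M S) :
    ∃ (Λ' : Type) (_ : Finite Λ') (_ : Inhabited Λ') (M' : TM0.Machine Γ Λ'),
      ∀ l, (TM0.eval M' l).Dom ↔ (TM0.eval M l).Dom := by
  classical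
  have := hS.to_subtype
  let _ : Inhabited S := ⟨⟨default, ss.1⟩⟩
  let g₁ : PointedMap Λ S :=
    ⟨fun q => if h : q ∈ S then ⟨q, h⟩ else default, by simp [ss.1]; rfl⟩
  let f : PointedMap Γ Γ := ⟨id, rfl⟩
  refine ⟨S, this, inferInstance, M.map f f g₁ Subtype.val, fun l => ?_⟩
  have hresp := TM0.Machine.map_respects M f f g₁ Subtype.val ss (fun _ => rfl)
    (fun q hq => by simp [g₁, hq])
  have hinit : TM0.Cfg.map f g₁ (TM0.init l : TM0.Cfg Γ Λ) = TM0.init l := by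
    rw [TM0.map_init]
    simp [f]
  exact StateTransition.tr_eval_dom hresp ⟨ss.1, hinit⟩

theorem PartrecToTM2.trNat_two_pow (m : ℕ) :
    trNat (2 ^ m) = List.replicate m Γ'.bit0 ++ [Γ'.bit1] := by
  have key : ∀ m : ℕ, ∃ p : PosNum, ((p : PosNum) : ℕ) = 2 ^ m ∧
      trPosNum p = List.replicate m Γ'.bit0 ++ [Γ'.bit1] := by
    intro m
    induction m with
    | zero => exact ⟨PosNum.one, by simp, rfl⟩
    | succ m ih =>
      obtain ⟨p, hp, h⟩ := ih
      exact ⟨p.bit0, by rw [PosNum.cast_bit0, hp]; ring, by simp [trPosNum, h, List.replicate_succ]⟩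
  obtain ⟨p, hp, h⟩ := key m
  have : ((2 ^ m : ℕ) : Num) = Num.pos p := by
    rw [← hp, ← Num.cast_pos, Num.of_to_nat]
  rw [trNat, this]
  exact h

/-- A program on inputs `2 ^ n` runs on a Turing machine with finitely many labels and symbols that
gets `n` in unary: in binary, `2 ^ n` is a `1` followed by `n` zeros. -/
theorem ToPartrec.Code.exists_machine (c : ToPartrec.Code) :
    ∃ (Γ Λ : Type) (_ : Finite Γ) (_ : Finite Λ) (_ : Inhabited Γ) (_ : Inhabited Λ)
      (M : TM0.Machine Γ Λ) (s b₁ b₀ : Γ),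
      ∀ n, (TM0.eval M (s :: b₁ :: List.replicate n b₀)).Dom ↔ (c.eval [2 ^ n]).Dom := by
  classical
  let _ : Inhabited PartrecToTM2.Λ' := ⟨PartrecToTM2.trNormal c PartrecToTM2.Cont'.halt⟩
  let P : PartrecToTM2.Λ' →
      TM2.Stmt (fun _ : PartrecToTM2.K' => PartrecToTM2.Γ') PartrecToTM2.Λ'
        (Option PartrecToTM2.Γ') := PartrecToTM2.tr
  have s2 : TM2.Supports P _ := PartrecToTM2.tr_supports c PartrecToTM2.Cont'.halt
  have s1 := TM2to1.tr_supports P s2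
  have s0 := TM1to0.tr_supports _ s1
  let _ : Fintype PartrecToTM2.K' :=
    ⟨{.main, .rev, .aux, .stack}, fun k => by cases k <;> simp⟩
  obtain ⟨Λ, hΛ, iΛ, M, hM⟩ := TM0.exists_finite_labels _ (Finset.finite_toSet _) s0
  let sym : PartrecToTM2.Γ' → TM2to1.Γ' PartrecToTM2.K' (fun _ => PartrecToTM2.Γ') := fun a =>
    (false, Function.update (fun _ => none) PartrecToTM2.K'.main (some a))
  refine ⟨_, Λ, Finite.of_fintype _, hΛ, inferInstance, iΛ, M, (true, (sym .cons).2),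
    sym .bit1, sym .bit0, fun n => ?_⟩
  have hinput : ((true, (sym .cons).2) :: sym .bit1 :: List.replicate n (sym .bit0)) =
      TM2to1.trInit PartrecToTM2.K'.main (PartrecToTM2.trList [2 ^ n]) := by
    simp only [TM2to1.trInit, PartrecToTM2.trList, PartrecToTM2.trNat_two_pow,
      List.append_assoc, List.reverse_append, List.reverse_replicate]
    have hmap : (List.replicate n PartrecToTM2.Γ'.bit0).map sym = List.replicate n (sym .bit0) :=
      List.map_replicate
    exact congrArg (fun t => (true, (sym .cons).2) :: sym .bit1 :: t) hmap.symm
  rw [hM, TM1to0.tr_eval]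
  refine (iff_of_eq (congrArg (fun l => (TM1.eval (TM2to1.tr P) l).Dom) hinput)).trans ?_
  rw [TM2to1.tr_eval_dom]
  have hinit : (TM2.init PartrecToTM2.K'.main (PartrecToTM2.trList [2 ^ n]) :
      TM2.Cfg (fun _ : PartrecToTM2.K' => PartrecToTM2.Γ') PartrecToTM2.Λ'
        (Option PartrecToTM2.Γ')) = PartrecToTM2.init c [2 ^ n] := by
    simp only [TM2.init, PartrecToTM2.init]
    congr 1
    funext k
    cases k <;> rfl
  have := PartrecToTM2.tr_eval c [2 ^ n]
  rw [TM2.eval, hinit]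
  exact iff_of_eq (congrArg Part.Dom this)

/-- There is a Turing machine with finitely many labels and symbols whose halting problem, posed
only for the inputs `s b₁ b₀ … b₀`, is undecidable. -/
theorem TM0.exists_undecidable_halting :
    ∃ (Γ Λ : Type) (_ : Finite Γ) (_ : Finite Λ) (_ : Inhabited Γ) (_ : Inhabited Λ)
      (M : TM0.Machine Γ Λ) (s b₁ b₀ : Γ),
      ¬ ComputablePred fun n : ℕ =>
        (TM0.eval M (s :: b₁ :: List.replicate (n + 1) b₀)).Dom := by
  -- On input `2 ^ (n + 1)` the machine runs the `n`-th program; `log` recovers `n + 1`.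
  let log (x : ℕ) : ℕ := Nat.findGreatest (fun k => 2 ^ k ≤ x) x
  let f : ℕ →. ℕ := fun x => (Denumerable.ofNat Nat.Partrec.Code (log x - 1)).eval 0
  have hlog : Computable log := by
    have hpow : Primrec₂ fun a b : ℕ => a ^ b := Primrec₂.unpaired'.1 Nat.Primrec.pow
    exact (Primrec.nat_findGreatest Primrec.id (Primrec.nat_le.comp₂
      (hpow.comp₂ (Primrec₂.const 2) Primrec₂.right) Primrec₂.left)).to_comp
  have hlog_pow (m : ℕ) : log (2 ^ m) = m := by
    rw [Nat.findGreatest_eq_iff]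
    refine ⟨m.lt_two_pow_self.le, fun _ => le_rfl, fun k hk _ h => ?_⟩
    exact absurd ((Nat.pow_le_pow_iff_right one_lt_two).1 h) hk.not_ge
  have hf : Partrec f := by
    refine Nat.Partrec.Code.eval_part.comp ?_ (Computable.const 0)
    exact (Computable.ofNat _).comp (Primrec.nat_sub.to_comp.comp hlog (Computable.const 1))
  obtain ⟨c, hc⟩ := ToPartrec.Code.exists_code (Nat.Partrec'.of_part
    (n := 1) (f := fun v => f v.head) (hf.comp (Primrec.vector_head.to_comp)))
  obtain ⟨Γ, Λ, hΓ, hΛ, iΓ, iΛ, M, s, b₁, b₀, h⟩ := ToPartrec.Code.exists_machine c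
  refine ⟨Γ, Λ, hΓ, hΛ, iΓ, iΛ, M, s, b₁, b₀, fun hcomp => ?_⟩
  refine ComputablePred.halting_problem 0 ?_
  refine (ComputablePred.computable_of_manyOneReducible
    (q := fun n : ℕ => (TM0.eval M (s :: b₁ :: List.replicate (n + 1) b₀)).Dom)
    ⟨Encodable.encode, Computable.encode, fun d => ?_⟩ hcomp)
  refine Iff.trans ?_ (h _).symm
  have := hc ⟨[2 ^ (Encodable.encode d + 1)], rfl⟩
  rw [this]
  simp only [f, List.Vector.head, hlog_pow, Nat.add_sub_cancel, Denumerable.ofNat_encode]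
  rfl

end Turing

/-! ### Simulating a Turing machine by a symmetric local rule -/

open Turing

/-- Numbers a tape by `1, 2, …`, folded at the head: the symbols at the distances `k` to the left
and `k + 1` to the right of the head share the number `k + 1`. The number `0` holds the pair of
number `1` swapped, so that moving the head shifts the two tracks uniformly, even at the fold. -/
def Turing.Tape.foldedCell {Γ : Type} [Inhabited Γ] (T : Tape Γ) : ℕ → Γ × Γ
  | 0 => (T.right.nth 0, T.head)
  | k + 1 => (T.left₀.nth k, T.right.nth k)

namespace Turing.Tape

variable {Γ : Type} [Inhabited Γ]

theorem foldedCell_zero (T : Tape Γ) : T.foldedCell 0 = (T.foldedCell 1).swap := by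
  simp [foldedCell, left₀]

theorem foldedCell_move_right (T : Tape Γ) (k : ℕ) :
    (T.move Dir.right).foldedCell (k + 1) =
      ((T.foldedCell k).1, (T.foldedCell (k + 2)).2) := by
  cases k <;> simp [foldedCell, left₀, move, ListBlank.nth_succ]

theorem foldedCell_move_left (T : Tape Γ) (k : ℕ) :
    (T.move Dir.left).foldedCell (k + 1) =
      ((T.foldedCell (k + 2)).1, (T.foldedCell k).2) := by
  cases k <;> simp [foldedCell, left₀, move, ListBlank.nth_succ]

theorem foldedCell_write_one (T : Tape Γ) (s : Γ) :
    (T.write s).foldedCell 1 = (s, (T.foldedCell 1).2) := by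
  simp [foldedCell, left₀, write]

theorem foldedCell_write (T : Tape Γ) (s : Γ) (k : ℕ) :
    (T.write s).foldedCell (k + 2) = T.foldedCell (k + 2) := by
  simp [foldedCell, left₀, write, ListBlank.nth_succ]

end Turing.Tape

/-- A nonwhite colour of the simulation. The cell with number `k` in a column remembers what the
previous column held at `k - 1`, `k`, `k + 1` (`none` where that column was white), together with
the machine state and head movement that the column is reached by. The `phase` is the time modulo
`3`; in a column where the machine has halted, `state` is `none`. -/
structure SimCell (Γ Λ : Type) where
  phase : ZMod 3
  state : Option Λ
  dir : Option Dir
  before : Option (Γ × Γ)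
  here : Option (Γ × Γ)
  after : Option (Γ × Γ)

namespace SimCell

variable {Γ Λ : Type}

instance [Finite Γ] [Finite Λ] : Finite (SimCell Γ Λ) := by
  have : Finite Dir := ⟨⟨fun d => match d with | .left => 0 | .right => 1, ![.left, .right],
    fun d => by cases d <;> rfl, fun i => by fin_cases i <;> rfl⟩⟩
  refine Finite.of_injective
    (fun c : SimCell Γ Λ => (c.phase, c.state, c.dir, c.before, c.here, c.after)) ?_
  rintro ⟨⟩ ⟨⟩ h
  simpa using h

/-- Appends what the previous column holds after the position of the next cell. -/
def extend (c : SimCell Γ Λ) (o : Option (Γ × Γ)) : SimCell Γ Λ :=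
  { c with before := c.here, here := c.after, after := o }

variable [Inhabited Γ]

/-- The two symbols of the folded tape held by a cell. -/
def content (c : SimCell Γ Λ) : Γ × Γ :=
  match c.dir with
  | none => c.here.getD default
  | some Dir.right => ((c.before.getD default).1, (c.after.getD default).2)
  | some Dir.left => ((c.after.getD default).1, (c.before.getD default).2)

variable [Inhabited Λ]

/-- The cell with number `0` of a column, from the cell with number `1` of the previous column,
which holds the machine state and the symbol at the head. -/
def first (M : TM0.Machine Γ Λ) (a : SimCell Γ Λ) : Option (SimCell Γ Λ) :=
  a.state.map fun q =>
    match M q a.content.1 with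
    | none => ⟨a.phase + 1, none, none, none, none, none⟩
    | some (q', .move d) =>
      ⟨a.phase + 1, some q', some d, none, some a.content.swap, some a.content⟩
    | some (q', .write s) =>
      ⟨a.phase + 1, some q', none, none, some (a.content.2, s), some (s, a.content.2)⟩

open Classical in
/-- The symmetric local rule. The phases tell which argument belongs to the previous column; if
they agree, the two arguments are mirror images on both sides of the diagonal. Below the last
nonwhite cell of the previous column, a column goes on until it has forgotten that cell, hence for
one more cell. -/
noncomputable def rule (M : TM0.Machine Γ Λ) :
    Option (SimCell Γ Λ) → Option (SimCell Γ Λ) → Option (SimCell Γ Λ)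
  | none, none => none
  | some c, none =>
    if c.state = none ∨ c.here = none ∧ c.after = none then none else some (c.extend none)
  | none, some c =>
    if c.state = none ∨ c.here = none ∧ c.after = none then none else some (c.extend none)
  | some a, some b =>
    if b.phase = a.phase + 1 then some (b.extend (some a.content))
    else if a.phase = b.phase + 1 then some (a.extend (some b.content))
    else if a = b then first M a
    else none

theorem phase_ne_add_two (t : ZMod 3) : t ≠ t + 1 + 1 := by
  revert t; decide

theorem rule_symm (M : TM0.Machine Γ Λ) (x y : Option (SimCell Γ Λ)) :
    rule M x y = rule M y x := by
  rcases x with _ | a <;> rcases y with _ | b <;> try rfl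
  simp only [rule]
  by_cases h₁ : b.phase = a.phase + 1
  · simp [h₁, phase_ne_add_two]
  · by_cases h₂ : a.phase = b.phase + 1
    · simp [h₂, phase_ne_add_two]
    · by_cases h₃ : a = b
      · simp [h₃]
      · simp [h₁, h₂, h₃, Ne.symm h₃]

theorem rule_self (M : TM0.Machine Γ Λ) (a : SimCell Γ Λ) :
    rule M (some a) (some a) = first M a := by
  simp [rule]

theorem rule_of_phase (M : TM0.Machine Γ Λ) {a b : SimCell Γ Λ} (h : b.phase = a.phase + 1) :
    rule M (some a) (some b) = some (b.extend (some a.content)) := by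
  simp [rule, h]

/-- A column `w` of colours that represents the machine configuration `c`: its cells up to number
`e` are the nonwhite ones. The content of the cell with number `0` plays no role. -/
structure IsConfig (w : ℕ → Option (SimCell Γ Λ)) (t : ZMod 3) (e : ℕ) (c : TM0.Cfg Γ Λ) :
    Prop where
  one_le : 1 ≤ e
  cell : ∀ k ≤ e, ∃ a, w k = some a ∧ a.phase = t ∧ a.state = some c.q ∧
    (1 ≤ k → a.content = c.Tape.foldedCell k)
  white : ∀ k, e < k → w k = none
  blank : ∀ k, e < k → c.Tape.foldedCell k = default

/-- The column after `w` under the local rule is `w'`. -/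
def Next (M : TM0.Machine Γ Λ) (w w' : ℕ → Option (SimCell Γ Λ)) : Prop :=
  w' 0 = rule M (w 1) (w 1) ∧ ∀ k, w' (k + 1) = rule M (w (k + 2)) (w' k)

/-- From a white cell on, a column stays white below the end of the previous column. -/
theorem Next.eq_none {M : TM0.Machine Γ Λ} {w w' : ℕ → Option (SimCell Γ Λ)} (h : Next M w w')
    {e k : ℕ} (hw : ∀ k, e < k → w k = none) (hk : w' k = none) (hek : e ≤ k + 1) :
    ∀ j, k ≤ j → w' j = none := by
  intro j hj
  induction j, hj using Nat.le_induction with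
  | base => exact hk
  | succ j hj ih => rw [h.2, ih, hw _ (by omega)]; rfl

/-- The common part of all machine steps: the tape after writing is `T`, and the head then moves
as `d` prescribes. -/
theorem Next.eq_some {M : TM0.Machine Γ Λ} {w w' : ℕ → Option (SimCell Γ Λ)} {t : ZMod 3} {e : ℕ}
    {c : TM0.Cfg Γ Λ} (h : Next M w w') (hw : IsConfig w t e c) {q : Λ} {d : Option Dir}
    {T : Tape Γ} (hT : ∀ k, T.foldedCell (k + 2) = c.Tape.foldedCell (k + 2))
    (h0 : w' 0 = some ⟨t + 1, some q, d, none, some (T.foldedCell 0), some (T.foldedCell 1)⟩) :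
    IsConfig w' (t + 1) (e + 1) ⟨q, match d with | none => T | some d => T.move d⟩ := by
  let o : ℕ → Option (Γ × Γ) := fun k => if k ≤ e then some (T.foldedCell k) else none
  have he := hw.one_le
  have blank : ∀ k, e < k → T.foldedCell k = default := by
    intro k hk
    obtain ⟨k, rfl⟩ := Nat.exists_eq_add_of_le' (show 2 ≤ k by omega)
    rw [hT, hw.blank _ hk]
  have ho : ∀ k, (o k).getD default = T.foldedCell k := by
    intro k
    by_cases hk : k ≤ e
    · simp [o, hk]
    · simp [o, hk, blank k (by omega)]
  have key : ∀ k ≤ e + 1, w' k = some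
      ⟨t + 1, some q, d, if k = 0 then none else o (k - 1), o k, o (k + 1)⟩ := by
    intro k
    induction k with
    | zero => intro _; rw [h0]; simp [o, he]
    | succ k ih =>
      intro hk
      rw [h.2, ih (by omega)]
      by_cases hk2 : k + 2 ≤ e
      · obtain ⟨a, ha, hat, -, hac⟩ := hw.cell _ hk2
        rw [ha, rule_of_phase _ (by simp [hat]), hac (by omega), ← hT]
        simp [extend, o, hk2]
      · rw [hw.white _ (by omega)]
        have : k ≤ e := by omega
        simp [rule, extend, o, hk2, this]
  have hcontent (k : ℕ) : (⟨t + 1, some q, d, if k + 1 = 0 then none else o (k + 1 - 1),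
        o (k + 1), o (k + 1 + 1)⟩ : SimCell Γ Λ).content =
      Tape.foldedCell (match d with | none => T | some d => T.move d) (k + 1) := by
    rcases d with _ | _ | _
    · simp [content, ho]
    · simp [content, ho, Tape.foldedCell_move_left]
    · simp [content, ho, Tape.foldedCell_move_right]
  refine ⟨by omega, fun k hk => ⟨_, key k hk, rfl, rfl, fun hk1 => ?_⟩, fun k hk => ?_,
    fun k hk => ?_⟩
  · obtain ⟨k, rfl⟩ := Nat.exists_eq_add_of_le' hk1
    exact hcontent k
  · refine h.eq_none hw.white (k := e + 2) ?_ (by omega) k (by omega)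
    rw [h.2, key (e + 1) le_rfl, hw.white _ (by omega)]
    simp [rule, o]
  · obtain ⟨k, rfl⟩ := Nat.exists_eq_add_of_le' (show 1 ≤ k by omega)
    have h₁ := blank k (by omega)
    have h₂ := blank (k + 1) (by omega)
    have h₃ := blank (k + 2) (by omega)
    rcases d with _ | _ | _
    · exact h₂
    · simp only [Tape.foldedCell_move_left, h₁, h₃]
    · simp only [Tape.foldedCell_move_right, h₁, h₃]

theorem IsConfig.next {M : TM0.Machine Γ Λ} {w w' : ℕ → Option (SimCell Γ Λ)} {t : ZMod 3}
    {e : ℕ} {c c' : TM0.Cfg Γ Λ} (hw : IsConfig w t e c) (h : Next M w w')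
    (hc : TM0.step M c = some c') : IsConfig w' (t + 1) (e + 1) c' := by
  obtain ⟨a, ha, rfl, hq, hac⟩ := hw.cell 1 hw.one_le
  have hac := hac le_rfl
  obtain ⟨q, T⟩ := c
  have hhead : (T.foldedCell 1).1 = T.head := by simp [Tape.foldedCell, Tape.left₀]
  have h0 := h.1
  rw [ha, rule_self, first, hq, Option.map_some, hac, hhead] at h0
  obtain ⟨⟨q', s⟩, hs, rfl⟩ := Option.map_eq_some_iff.1 hc
  rcases s with d | s
  · simp only [hs, ← Tape.foldedCell_zero] at h0
    exact Next.eq_some h hw (T := T) (d := some d) (fun _ => rfl) h0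
  · simp only [hs, ← Tape.foldedCell_write_one T s] at h0
    refine Next.eq_some h hw (T := T.write s) (d := none) (Tape.foldedCell_write T s) ?_
    rw [h0, Tape.foldedCell_zero, Tape.foldedCell_write_one]
    rfl

/-- If the machine halts, then all nonwhite cells of the next column are in the halted state, and
the column after it is white. -/
theorem IsConfig.halt {M : TM0.Machine Γ Λ} {w w' w'' : ℕ → Option (SimCell Γ Λ)} {t : ZMod 3}
    {e : ℕ} {c : TM0.Cfg Γ Λ} (hw : IsConfig w t e c) (h : Next M w w') (h' : Next M w' w'')
    (hc : TM0.step M c = none) : (∀ k, e < k → w' k = none) ∧ ∀ k, w'' k = none := by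
  have he := hw.one_le
  have dead : ∀ k < e, ∃ a, w' k = some a ∧ a.phase = t + 1 ∧ a.state = none := by
    intro k
    induction k with
    | zero =>
      intro _
      obtain ⟨a, ha, rfl, hq, hac⟩ := hw.cell 1 hw.one_le
      have hhead : (c.Tape.foldedCell 1).1 = c.Tape.head := by simp [Tape.foldedCell, Tape.left₀]
      rw [h.1, ha, rule_self, first, hq, hac le_rfl, hhead]
      have hs : M c.q c.Tape.head = none := Option.map_eq_none_iff.1 hc
      exact ⟨_, rfl, by simp [hs], by simp [hs]⟩
    | succ k ih =>
      intro hk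
      obtain ⟨b, hb, hbt, hbs⟩ := ih (by omega)
      rw [h.2, hb]
      by_cases hk2 : k + 2 ≤ e
      · obtain ⟨a, ha, hat, -⟩ := hw.cell _ hk2
        rw [ha, rule_of_phase _ (by rw [hat, hbt])]
        exact ⟨_, rfl, hbt, hbs⟩
      · omega
  have white : ∀ k, e ≤ k → w' k = none := by
    obtain ⟨b, hb, -, hbs⟩ := dead (e - 1) (by omega)
    have : w' e = none := by
      obtain ⟨e, rfl⟩ := Nat.exists_eq_add_of_le' he
      rw [h.2, hw.white _ (by omega), show w' e = some b from hb]
      simp [rule, hbs]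
    exact h.eq_none hw.white this (by omega)
  have state : ∀ k, w' k = none ∨ ∃ a, w' k = some a ∧ a.state = none := by
    intro k
    by_cases hk : k < e
    · obtain ⟨a, ha, -, hs⟩ := dead k hk
      exact .inr ⟨a, ha, hs⟩
    · exact .inl (white k (by omega))
  refine ⟨fun k hk => white k hk.le, fun k => ?_⟩
  induction k with
  | zero =>
    rw [h'.1]
    rcases state 1 with h1 | ⟨a, h1, hs⟩
    · rw [h1]; rfl
    · rw [h1, rule_self, first, hs]; rfl
  | succ k ih =>
    rw [h'.2, ih]
    rcases state (k + 2) with h1 | ⟨a, h1, hs⟩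
    · rw [h1]; rfl
    · simp [h1, rule, hs]

theorem Next.eq_none_of_white {M : TM0.Machine Γ Λ} {w w' : ℕ → Option (SimCell Γ Λ)}
    (h : Next M w w') (hw : ∀ k, w k = none) (k : ℕ) : w' k = none :=
  h.eq_none (e := 0) (k := 0) (fun k _ => hw k) (by rw [h.1, hw]; rfl) (by omega) k (by omega)

/-- The sequence of columns is eventually white in all directions if and only if the machine
halts. -/
theorem eventually_white_iff {M : TM0.Machine Γ Λ} {W : ℕ → ℕ → Option (SimCell Γ Λ)}
    (hW : ∀ i, Next M (W i) (W (i + 1))) {l : List Γ} {t : ZMod 3} {e : ℕ}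
    (h0 : IsConfig (W 0) t e (TM0.init l)) :
    (∃ N, ∀ i k, N < i + k → W i k = none) ↔ (TM0.eval M l).Dom := by
  constructor
  · rintro ⟨N, hN⟩
    by_contra hdom
    have : ∀ i, ∃ t e c, StateTransition.Reaches (TM0.step M) (TM0.init l) c ∧
        IsConfig (W i) t e c := by
      intro i
      induction i with
      | zero => exact ⟨_, _, _, .refl, h0⟩
      | succ i ih =>
        obtain ⟨t, e, c, hc, hi⟩ := ih
        rcases hs : TM0.step M c with _ | c'
        · exact absurd (Part.dom_iff_mem.2 ⟨c, StateTransition.mem_eval.2 ⟨hc, hs⟩⟩) hdom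
        · exact ⟨_, _, _, hc.tail hs, hi.next (hW i) hs⟩
    obtain ⟨t, e, c, -, hc⟩ := this (N + 1)
    obtain ⟨a, ha, -⟩ := hc.cell 0 (by omega)
    rw [hN _ _ (by omega)] at ha
    cases ha
  · intro hdom
    obtain ⟨c, hc⟩ := Part.dom_iff_mem.1 (show (StateTransition.eval (TM0.step M) _).Dom from hdom)
    obtain ⟨hr, hs⟩ := StateTransition.mem_eval.1 hc
    clear hc
    have : ∃ i t e, IsConfig (W i) t e c ∧ ∀ i' ≤ i, ∀ k, e < k → W i' k = none := by
      clear hs hdom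
      induction hr with
      | refl => exact ⟨0, t, e, h0, fun i' hi' k hk => by
          obtain rfl : i' = 0 := by omega
          exact h0.white k hk⟩
      | tail _ hs ih =>
        obtain ⟨i, t, e, hi, hlt⟩ := ih
        have hi' := hi.next (hW i) hs
        refine ⟨i + 1, _, _, hi', fun i' hle k hk => ?_⟩
        rcases Nat.le_succ_iff.1 hle with hle | rfl
        · exact hlt i' hle k (by omega)
        · exact hi'.white k hk
    obtain ⟨i, t, e, hi, hlt⟩ := this
    obtain ⟨h₁, h₂⟩ := hi.halt (hW i) (hW (i + 1)) hs
    have h₃ : ∀ j k, W (i + 2 + j) k = none := by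
      intro j
      induction j with
      | zero => exact h₂
      | succ j ih => exact (hW _).eq_none_of_white ih
    refine ⟨i + 2 + e, fun i' k hk => ?_⟩
    rcases le_or_gt i' i with h | h
    · exact hlt i' h k (by omega)
    rcases Nat.lt_or_ge i' (i + 2) with h' | h'
    · obtain rfl : i' = i + 1 := by omega
      exact h₁ k (by omega)
    · obtain ⟨j, rfl⟩ := Nat.exists_eq_add_of_le h'
      exact h₃ j k

end SimCell

/-! ### Recurrent sheets of colours and of numbers -/

/-- The double sequence with border `init` and with local rule `R`. -/
def recurrentSheet {Q : Type} (R : Q → Q → Q) (init : ℕ → Q) : ℕ → ℕ → Q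
  | 0, j => init j
  | i + 1, 0 => init (i + 1)
  | i + 1, j + 1 => R (recurrentSheet R init i (j + 1)) (recurrentSheet R init (i + 1) j)
termination_by i j => (i, j)

theorem recurrentSheet_symm {Q : Type} {R : Q → Q → Q} (hR : ∀ x y, R x y = R y x)
    (init : ℕ → Q) (i j : ℕ) : recurrentSheet R init i j = recurrentSheet R init j i := by
  fun_induction recurrentSheet R init i j with
  | case1 j => cases j <;> simp [recurrentSheet]
  | case2 i => simp [recurrentSheet]
  | case3 i j h₁ h₂ => rw [h₁, h₂, hR]; simp [recurrentSheet]

/-- The border `b, b, a, …, a, w, w, …` with `m + 1` entries `a`. -/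
def inputBorder {Q : Type} (w b a : Q) (m k : ℕ) : Q :=
  if k ≤ 1 then b else if k ≤ m + 2 then a else w

/-- For every Turing machine there are a finite set of colours and a symmetric local rule such
that the sheets bordered by the input `s b₁ b₀ … b₀` are eventually white exactly if the machine
halts on this input. -/
theorem Turing.TM0.exists_symmetric_rule {Γ Λ : Type} [Finite Γ] [Finite Λ] [Inhabited Γ]
    [Inhabited Λ] (M : TM0.Machine Γ Λ) (s b₁ b₀ : Γ) :
    ∃ (Q : Type) (_ : Finite Q) (R : Q → Q → Q) (w b a : Q),
      (∀ x y, R x y = R y x) ∧ b ≠ w ∧ a ≠ w ∧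
      ∀ m, (∃ N, ∀ i j, N < i + j → recurrentSheet R (inputBorder w b a m) i j = w) ↔
        (TM0.eval M (s :: b₁ :: List.replicate (m + 1) b₀)).Dom := by
  refine ⟨Option (SimCell Γ Λ), inferInstance, SimCell.rule M, none,
    some ⟨0, some default, none, none, some (s, b₁), none⟩,
    some ⟨0, some default, none, none, some (default, b₀), none⟩,
    SimCell.rule_symm M, by simp, by simp, fun m => ?_⟩
  set border := inputBorder (none : Option (SimCell Γ Λ))
    (some ⟨0, some default, none, none, some (s, b₁), none⟩)
    (some ⟨0, some default, none, none, some (default, b₀), none⟩) m with hborder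
  set v := recurrentSheet (SimCell.rule M) border with hv
  have hsymm : ∀ i j, v i j = v j i := recurrentSheet_symm (SimCell.rule_symm M) border
  have hrec : ∀ i j, v (i + 1) (j + 1) = SimCell.rule M (v i (j + 1)) (v (i + 1) j) := by
    intro i j
    rw [hv, recurrentSheet]
  have hW : ∀ i, SimCell.Next M (fun k => v i (i + k)) (fun k => v (i + 1) (i + 1 + k)) := by
    refine fun i => ⟨?_, fun k => ?_⟩
    · simp only [add_zero]
      rw [hrec, hsymm (i + 1) i]
    · show v (i + 1) (i + 1 + k + 1) = _
      rw [hrec]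
      congr 2
      ring
  have h0 : SimCell.IsConfig (fun k => v 0 (0 + k)) 0 (m + 2)
      (TM0.init (s :: b₁ :: List.replicate (m + 1) b₀) : TM0.Cfg Γ Λ) := by
    have hv0 : ∀ k, v 0 (0 + k) = border k := by
      intro k
      rw [hv, zero_add, recurrentSheet]
    have hfold : ∀ k, (Tape.mk₁ (s :: b₁ :: List.replicate (m + 1) b₀)).foldedCell (k + 2) =
        (default, (List.replicate (m + 1) b₀).getI k) := by
      intro k
      simp only [Tape.foldedCell, Tape.mk₁, Tape.mk₂, Tape.mk', Tape.left₀, ListBlank.nth_succ,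
        ListBlank.tail_cons, ListBlank.tail_mk, List.tail_cons, ListBlank.nth_mk]
      simp [List.getI]
    refine ⟨by omega, fun k hk => ?_, fun k hk => ?_, fun k hk => ?_⟩
    · simp only [hv0]
      rcases k with _ | _ | k
      · exact ⟨_, by simp only [hborder, inputBorder]; rfl, rfl, rfl, by simp⟩
      · exact ⟨_, by simp only [hborder, inputBorder]; rfl, rfl, rfl, fun _ => rfl⟩
      · refine ⟨_, by rw [hborder, inputBorder, if_neg (by omega), if_pos hk], rfl, rfl,
          fun _ => ?_⟩
        refine Eq.trans ?_ (hfold k).symm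
        rw [List.getI_eq_getElem _ (by simpa using (by omega : k < m + 1)), List.getElem_replicate]
        rfl
    · simp only [hv0]
      rw [hborder, inputBorder, if_neg (by omega), if_neg (by omega)]
    · obtain ⟨k, rfl⟩ := Nat.exists_eq_add_of_le' (show 2 ≤ k by omega)
      refine (hfold k).trans ?_
      rw [List.getI_eq_default _ (by simpa using (by omega : m + 1 ≤ k))]
      rfl
  rw [← SimCell.eventually_white_iff (W := fun i k => v i (i + k)) hW h0]
  constructor
  · rintro ⟨N, hN⟩
    exact ⟨N, fun i k hk => hN _ _ (by omega)⟩
  · rintro ⟨N, hN⟩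
    have key : ∀ i j, 2 * N < i + j → i ≤ j → v i j = none := by
      intro i j hij hle
      obtain ⟨k, rfl⟩ := Nat.exists_eq_add_of_le hle
      exact hN i k (by omega)
    refine ⟨2 * N, fun i j hij => ?_⟩
    rcases le_total i j with h | h
    · exact key i j hij h
    · rw [hsymm]
      exact key j i (by omega) h

/-- The double sequence of numbers with border `1` and with local rule `f`. -/
def numberSheet (f : ℕ → ℕ → ℕ) : ℕ → ℕ → ℕ := recurrentSheet f fun _ => 1

section Numbering

variable {Q : Type} [Primcodable Q] (R : Q → Q → Q) (w b a : Q)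

/-- The colour denoted by a number. The numbers `2, 3, …, m + 4` denote the input `b, b, a, …, a`,
so that they can be written one after another along the border; from `m + 5` on, the numbers
denote all colours, in the order of their codes. The start symbol `1` denotes no colour. -/
def numberColour (m x : ℕ) : Q :=
  if x ≤ 1 then w else if x ≤ 3 then b else if x ≤ m + 4 then a
  else (Encodable.decode (x - (m + 5))).getD w

open Classical in
/-- The number under which the local rule produces a colour. -/
noncomputable def colourNumber (m : ℕ) (q : Q) : ℕ :=
  if q = w then 0 else m + 5 + Encodable.encode q

/-- The successor of a number along the border. -/
def borderSucc (m x : ℕ) : ℕ := if 1 ≤ x ∧ x < m + 4 then x + 1 else 0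

/-- The local rule on numbers: next to the border it counts, elsewhere it applies `R`. -/
noncomputable def numberRule (m x y : ℕ) : ℕ :=
  if x = 1 then borderSucc m y else if y = 1 then borderSucc m x
  else colourNumber w m (R (numberColour w b a m x) (numberColour w b a m y))

variable {R w b a}

theorem numberRule_symm (hR : ∀ x y, R x y = R y x) (m x y : ℕ) :
    numberRule R w b a m x y = numberRule R w b a m y x := by
  unfold numberRule
  rw [hR]
  split_ifs <;> simp_all

theorem numberRule_lt {n : ℕ} (hn : ∀ q : Q, Encodable.encode q < n) (m x y : ℕ) :
    numberRule R w b a m x y < m + 5 + n := by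
  have := hn (R (numberColour w b a m x) (numberColour w b a m y))
  unfold numberRule borderSucc colourNumber
  split_ifs <;> omega

theorem numberRule_ne_one (m x y : ℕ) : numberRule R w b a m x y ≠ 1 := by
  unfold numberRule borderSucc colourNumber
  split_ifs <;> omega

theorem numberColour_colourNumber (m : ℕ) (q : Q) :
    numberColour w b a m (colourNumber w m q) = q := by
  unfold colourNumber
  split_ifs with h
  · simp [numberColour, h]
  · have h₁ : ¬ m + 5 + Encodable.encode q ≤ 1 := by omega
    have h₂ : ¬ m + 5 + Encodable.encode q ≤ 3 := by omega
    have h₃ : ¬ m + 5 + Encodable.encode q ≤ m + 4 := by omega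
    simp [numberColour, h₁, h₂, h₃]

theorem colourNumber_eq_zero (m : ℕ) (q : Q) : colourNumber w m q = 0 ↔ q = w := by
  unfold colourNumber
  split_ifs with h <;> simp [h]

theorem numberSheet_border (m j : ℕ) :
    numberSheet (numberRule R w b a m) 1 (j + 1) = if j ≤ m + 2 then j + 2 else 0 := by
  have step : ∀ j, numberSheet (numberRule R w b a m) 1 (j + 1) =
      borderSucc m (numberSheet (numberRule R w b a m) 1 j) := by
    intro j
    rw [numberSheet, recurrentSheet, recurrentSheet, numberRule, if_pos rfl]
  induction j with
  | zero => rw [step, numberSheet, recurrentSheet]; simp [borderSucc]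
  | succ j ih =>
    rw [step, ih, borderSucc]
    split_ifs <;> omega

/-- Apart from its borders, the sheet of numbers denotes the sheet of colours, and its zeros are
the white colours. -/
theorem numberSheet_spec (hR : ∀ x y, R x y = R y x) (hb : b ≠ w) (ha : a ≠ w) (m i j : ℕ) :
    numberColour w b a m (numberSheet (numberRule R w b a m) (i + 1) (j + 1)) =
        recurrentSheet R (inputBorder w b a m) i j ∧
      (numberSheet (numberRule R w b a m) (i + 1) (j + 1) = 0 ↔
        recurrentSheet R (inputBorder w b a m) i j = w) := by
  have border : ∀ j,
      numberColour w b a m (numberSheet (numberRule R w b a m) 1 (j + 1)) =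
        recurrentSheet R (inputBorder w b a m) 0 j ∧
      (numberSheet (numberRule R w b a m) 1 (j + 1) = 0 ↔
        recurrentSheet R (inputBorder w b a m) 0 j = w) := by
    intro j
    rw [numberSheet_border, recurrentSheet, inputBorder, numberColour]
    rcases le_or_gt j 1 with h | h
    · simp [show j ≤ m + 2 by omega, h, hb]
    · rcases le_or_gt j (m + 2) with h' | h'
      · simp [h', show ¬ j ≤ 1 by omega, ha]
      · simp [show ¬ j ≤ 1 by omega, show ¬ j ≤ m + 2 by omega]
  induction i generalizing j with
  | zero => exact border j
  | succ i ihi =>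
    induction j with
    | zero =>
      have h₁ := recurrentSheet_symm (numberRule_symm (w := w) (b := b) (a := a) hR m)
        (fun _ => 1) (i + 1 + 1) (0 + 1)
      rw [numberSheet, h₁, recurrentSheet_symm hR]
      exact border (i + 1)
    | succ j ihj =>
      have ne_one : ∀ i j, numberSheet (numberRule R w b a m) (i + 1) (j + 1) ≠ 1 := by
        intro i j
        rw [numberSheet, recurrentSheet]
        exact numberRule_ne_one _ _ _
      have h := ihi (j + 1)
      have h₁ := ne_one i (j + 1)
      have h₂ := ne_one (i + 1) j
      have : numberSheet (numberRule R w b a m) (i + 1 + 1) (j + 1 + 1) =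
          colourNumber w m (recurrentSheet R (inputBorder w b a m) (i + 1) (j + 1)) := by
        rw [recurrentSheet, ← h.1, ← ihj.1]
        conv_lhs =>
          rw [numberSheet, recurrentSheet, ← numberSheet, numberRule, if_neg h₁, if_neg h₂]
      rw [this, numberColour_colourNumber, colourNumber_eq_zero]
      exact ⟨rfl, Iff.rfl⟩

/-- The sheet of numbers is eventually zero exactly if the sheet of colours is eventually white. -/
theorem numberSheet_eventually_zero_iff (hR : ∀ x y, R x y = R y x) (hb : b ≠ w) (ha : a ≠ w)
    (m : ℕ) :
    (∃ N, ∀ i j, 0 < i ∧ 0 < j ∧ i + j > N → numberSheet (numberRule R w b a m) i j = 0) ↔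
      ∃ N, ∀ i j, N < i + j → recurrentSheet R (inputBorder w b a m) i j = w := by
  constructor
  · rintro ⟨N, hN⟩
    exact ⟨N, fun i j hij => (numberSheet_spec hR hb ha m i j).2.1
      (hN _ _ ⟨by omega, by omega, by omega⟩)⟩
  · rintro ⟨N, hN⟩
    refine ⟨N + 2, fun i j ⟨hi, hj, hij⟩ => ?_⟩
    obtain ⟨i, rfl⟩ := Nat.exists_eq_add_of_le' hi
    obtain ⟨j, rfl⟩ := Nat.exists_eq_add_of_le' hj
    exact (numberSheet_spec hR hb ha m i j).2.2 (hN _ _ (by omega))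

open Primrec in
theorem primrec_numberRule [Finite Q] :
    Primrec fun v : ℕ × ℕ × ℕ => numberRule R w b a v.1 v.2.1 v.2.2 := by
  classical
  have hcol : Primrec₂ (numberColour w b a) := by
    have hle (c : ℕ × ℕ → ℕ) (hc : Primrec c) : PrimrecPred fun v : ℕ × ℕ => v.2 ≤ c v :=
      Primrec.nat_le.comp snd hc
    refine ite (hle _ (const 1)) (const w) (ite (hle _ (const 3)) (const b)
      (ite (hle _ (nat_add.comp fst (const 4))) (const a) ?_))
    exact option_getD.comp (Primrec.decode.comp
      (nat_sub.comp snd (nat_add.comp fst (const 5)))) (const w)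
  have hnum : Primrec₂ (colourNumber w) :=
    ite (Primrec.eq.comp snd (const w)) (const 0)
      (nat_add.comp (nat_add.comp fst (const 5)) (Primrec.encode.comp snd))
  have hsucc : Primrec₂ borderSucc :=
    ite ((Primrec.nat_le.comp (const 1) snd).and (Primrec.nat_lt.comp snd
      (nat_add.comp fst (const 4)))) (Primrec.succ.comp snd) (const 0)
  have hR : Primrec fun q : Q × Q => R q.1 q.2 := Primrec.dom_finite _
  have hx : Primrec fun v : ℕ × ℕ × ℕ => v.2.1 := fst.comp snd
  have hy : Primrec fun v : ℕ × ℕ × ℕ => v.2.2 := snd.comp snd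
  refine ite (Primrec.eq.comp hx (const 1)) (hsucc.comp fst hy)
    (ite (Primrec.eq.comp hy (const 1)) (hsucc.comp fst hx) (hnum.comp fst ?_))
  exact hR.comp (Primrec.pair (hcol.comp fst hx) (hcol.comp fst hy))

end Numbering

/-! ### Interpolation over a prime field -/

/-- The coefficient of `x ^ k` in `1 - (x - a) ^ (p - 1)`, a polynomial over `ℤ/pℤ` that is `1`
at `a` and `0` elsewhere, as a natural number; here `p - 1` stands for `-1`. -/
def deltaCoeff (p a k : ℕ) : ℕ := (if k = 0 then 1 else 0) + (p - 1) * a ^ (p - 1 - k)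

theorem sum_deltaCoeff {p : ℕ} [Fact p.Prime] (x a : ZMod p) :
    ∑ k ∈ Finset.range p, (deltaCoeff p a.val k : ZMod p) * x ^ k = if x = a then 1 else 0 := by
  have hp : 1 ≤ p := (Fact.out : p.Prime).one_le
  have hneg : ((p - 1 : ℕ) : ZMod p) = -1 := by simp [Nat.cast_sub hp]
  have hsum : ∑ k ∈ Finset.range p, (deltaCoeff p a.val k : ZMod p) * x ^ k =
      1 - ∑ k ∈ Finset.range p, x ^ k * a ^ (p - 1 - k) := by
    have : ∀ k ∈ Finset.range p, (deltaCoeff p a.val k : ZMod p) * x ^ k =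
        (if k = 0 then 1 else 0) - x ^ k * a ^ (p - 1 - k) := by
      intro k _
      rw [deltaCoeff, Nat.cast_add, Nat.cast_mul, Nat.cast_pow, hneg, ZMod.natCast_zmod_val]
      split_ifs with h
      · subst h; push_cast; ring
      · push_cast; ring
    rw [Finset.sum_congr rfl this, Finset.sum_sub_distrib]
    simp [show 0 < p from hp]
  rw [hsum]
  split_ifs with h
  · -- here all `p` powers in the sum agree
    subst h
    have : ∀ k ∈ Finset.range p, x ^ k * x ^ (p - 1 - k) = x ^ (p - 1) := by
      intro k hk
      rw [← pow_add]
      congr 1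
      have := Finset.mem_range.1 hk
      omega
    rw [Finset.sum_congr rfl this]
    simp
  · -- by Fermat's little theorem the geometric sum is `(x - a) / (x - a)`
    have := Commute.geom_sum₂_mul (Commute.all x a) p
    rw [ZMod.pow_card, ZMod.pow_card] at this
    rw [mul_right_cancel₀ (sub_ne_zero.2 h) (this.trans (one_mul _).symm), sub_self]

/-- The terms of the polynomial over `ℤ/pℤ` that interpolates `f` at all points of the plane. -/
def interpolationTerms (p : ℕ) (f : ℕ → ℕ → ℕ) : List (List ℕ × ℕ × ℕ) :=
  (List.range p).flatMap fun a => (List.range p).flatMap fun b =>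
    (List.range p).flatMap fun k => (List.range p).map fun l =>
      ([f a b * (deltaCoeff p a k * deltaCoeff p b l)], k, l)

theorem primrec_interpolationTerms {f : ℕ → ℕ → ℕ → ℕ} {p : ℕ → ℕ}
    (hf : Primrec fun v : ℕ × ℕ × ℕ => f v.1 v.2.1 v.2.2) (hp : Primrec p) :
    Primrec fun m => interpolationTerms (p m) (f m) := by
  have hpow : Primrec₂ fun a b : ℕ => a ^ b := Primrec₂.unpaired'.1 Nat.Primrec.pow
  have hd : Primrec fun v : ℕ × ℕ × ℕ => deltaCoeff v.1 v.2.1 v.2.2 := by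
    have hx : Primrec fun v : ℕ × ℕ × ℕ => v.2.1 := Primrec.fst.comp Primrec.snd
    have hy : Primrec fun v : ℕ × ℕ × ℕ => v.2.2 := Primrec.snd.comp Primrec.snd
    have h1 : Primrec fun v : ℕ × ℕ × ℕ => v.1 - 1 :=
      Primrec.nat_sub.comp Primrec.fst (Primrec.const 1)
    exact Primrec.nat_add.comp (Primrec.ite (Primrec.eq.comp hy (Primrec.const 0))
      (Primrec.const 1) (Primrec.const 0))
      (Primrec.nat_mul.comp h1 (hpow.comp hx (Primrec.nat_sub.comp h1 hy)))
  -- the variables bound one after another: `m`, `a`, `b`, `k`, `l`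
  have hrange {α : Type} [Primcodable α] {g : α → ℕ} (hg : Primrec g) :
      Primrec fun x => List.range (p (g x)) := Primrec.list_range.comp (hp.comp hg)
  refine Primrec.list_flatMap (hrange .id) ?_
  refine Primrec.list_flatMap (hrange .fst) ?_
  refine Primrec.list_flatMap (hrange (.comp .fst .fst)) ?_
  refine Primrec.list_map (hrange (.comp .fst (.comp .fst .fst))) ?_
  have hl : Primrec fun v : (((ℕ × ℕ) × ℕ) × ℕ) × ℕ => v.2 := .snd
  have hk : Primrec fun v : (((ℕ × ℕ) × ℕ) × ℕ) × ℕ => v.1.2 := .comp .snd .fst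
  have hb : Primrec fun v : (((ℕ × ℕ) × ℕ) × ℕ) × ℕ => v.1.1.2 := .comp .snd (.comp .fst .fst)
  have ha : Primrec fun v : (((ℕ × ℕ) × ℕ) × ℕ) × ℕ => v.1.1.1.2 :=
    .comp .snd (.comp .fst (.comp .fst .fst))
  have hm : Primrec fun v : (((ℕ × ℕ) × ℕ) × ℕ) × ℕ => v.1.1.1.1 :=
    .comp .fst (.comp .fst (.comp .fst .fst))
  refine Primrec.pair (Primrec.list_cons.comp ?_ (Primrec.const [])) (hk.pair hl)
  exact Primrec.nat_mul.comp (hf.comp (hm.pair (ha.pair hb)))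
    (Primrec.nat_mul.comp (hd.comp ((hp.comp hm).pair (ha.pair hk)))
      (hd.comp ((hp.comp hm).pair (hb.pair hl))))

open RawCode in
theorem RawCode.isValid_of_modulus_X {p : ℕ} (hp : p.Prime) (F : List (List ℕ × ℕ × ℕ)) :
    IsValid (p, [0, 1], F) := by
  have : Fact p.Prime := ⟨hp⟩
  refine ⟨hp, ?_⟩
  have : modulus (p, [0, 1], F) = (Polynomial.X : Polynomial (ZMod p)) := by
    simp [modulus, listPoly]
  rw [this]
  exact Polynomial.irreducible_X

/-- The code of the system over the prime field `ℤ/pℤ`, written as `ℤ/pℤ[t]/(t)`, whose polynomial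
interpolates `f`. -/
def primeFieldCode {p : ℕ} (hp : p.Prime) (f : ℕ → ℕ → ℕ) : FieldSystemCode :=
  ⟨(p, [0, 1], interpolationTerms p f), RawCode.isValid_of_modulus_X hp _⟩

section

variable {p : ℕ} (hp : p.Prime) (f : ℕ → ℕ → ℕ)

theorem primeFieldCode_modulus : (primeFieldCode hp f).1.modulus = Polynomial.X := by
  show RawCode.listPoly p [0, 1] = Polynomial.X
  simp [RawCode.listPoly]

theorem primeFieldCode_isPrimeField : (primeFieldCode hp f).IsPrimeField := by
  have : Fact p.Prime := ⟨hp⟩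
  have hmod := primeFieldCode_modulus hp f
  have hX : Nat.card (AdjoinRoot (Polynomial.X : Polynomial (ZMod p))) = p := by
    let pb := AdjoinRoot.powerBasis (K := ZMod p) (f := Polynomial.X) Polynomial.X_ne_zero
    have : Module.Finite (ZMod p) (AdjoinRoot (Polynomial.X : Polynomial (ZMod p))) := pb.finite
    have hc := Module.natCard_eq_pow_finrank (K := ZMod p)
      (V := AdjoinRoot (Polynomial.X : Polynomial (ZMod p)))
    rw [pb.finrank, AdjoinRoot.powerBasis_dim, Polynomial.natDegree_X, pow_one, Nat.card_zmod] at hc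
    exact hc
  unfold FieldSystemCode.IsPrimeField FieldSystemCode.K
  rw [hmod]
  exact hX.symm ▸ hp

theorem primeFieldCode_poly : (primeFieldCode hp f).poly =
    ∑ a ∈ Finset.range p, ∑ b ∈ Finset.range p, ∑ k ∈ Finset.range p, ∑ l ∈ Finset.range p,
      MvPolynomial.C
          ((f a b * (deltaCoeff p a k * deltaCoeff p b l) : ℕ) : (primeFieldCode hp f).K) *
        MvPolynomial.X 0 ^ k * MvPolynomial.X 1 ^ l := by
  have hterm : ∀ n : ℕ, AdjoinRoot.mk (primeFieldCode hp f).1.modulus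
      (RawCode.listPoly p [n]) = (n : (primeFieldCode hp f).K) := by
    intro n
    have : RawCode.listPoly p [n] = (n : Polynomial (ZMod p)) := by simp [RawCode.listPoly]
    rw [this]
    exact map_natCast _ n
  simp only [← hterm]
  have hflat {α β : Type} {S : Type} [AddCommMonoid S] (l : List α) (g : α → List β)
      (h : β → S) : ((l.flatMap g).map h).sum = (l.map fun x => ((g x).map h).sum).sum := by
    induction l with
    | nil => rfl
    | cons x l ih => simp [ih]
  have hsum {S : Type} [AddCommMonoid S] (g : ℕ → S) :
      ((List.range p).map g).sum = ∑ k ∈ Finset.range p, g k := by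
    rw [← Multiset.sum_coe]
    rfl
  rw [FieldSystemCode.poly]
  show ((interpolationTerms p f).map _).sum = _
  simp only [interpolationTerms, hflat, hsum, List.map_map]
  rfl

theorem primeFieldCode_isSymmetric (hf : ∀ x y, f x y = f y x) :
    (primeFieldCode hp f).poly.IsSymmetric := by
  intro e
  have he : e = 1 ∨ e = Equiv.swap 0 1 := by
    revert e; decide
  rcases he with rfl | rfl
  · exact MvPolynomial.rename_id_apply _
  · rw [primeFieldCode_poly]
    simp only [map_sum, map_mul, map_pow, MvPolynomial.rename_C, MvPolynomial.rename_X,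
      Equiv.swap_apply_left, Equiv.swap_apply_right]
    rw [Finset.sum_comm]
    refine Finset.sum_congr rfl fun b _ => Finset.sum_congr rfl fun a _ => ?_
    rw [Finset.sum_comm]
    refine Finset.sum_congr rfl fun l _ => Finset.sum_congr rfl fun k _ => ?_
    rw [hf a b, mul_comm (deltaCoeff p a k), mul_right_comm]

/-- The natural map from `ℤ/pℤ` to the coded field. -/
noncomputable def primeFieldHom : ZMod p →+* (primeFieldCode hp f).K := AdjoinRoot.of _

theorem primeFieldCode_natCast_eq_zero {x : ℕ} (hx : x < p) :
    (x : (primeFieldCode hp f).K) = 0 ↔ x = 0 := by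
  have : Fact p.Prime := ⟨hp⟩
  have : Nontrivial (primeFieldCode hp f).K := (FieldSystemCode.isField_K _).nontrivial
  rw [← map_natCast (primeFieldHom hp f), map_eq_zero, ZMod.natCast_eq_zero_iff]
  exact ⟨fun h => Nat.eq_zero_of_dvd_of_lt h hx, fun h => h ▸ dvd_zero p⟩

theorem primeFieldCode_eval {x y : ℕ} (hx : x < p) (hy : y < p) :
    (primeFieldCode hp f).system.f (x : (primeFieldCode hp f).K) (y : (primeFieldCode hp f).K) =
      (f x y : (primeFieldCode hp f).K) := by
  have : Fact p.Prime := ⟨hp⟩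
  have delta : ∀ {x a : ℕ}, x < p → a < p →
      ∑ k ∈ Finset.range p, (deltaCoeff p a k : (primeFieldCode hp f).K) *
        (x : (primeFieldCode hp f).K) ^ k = if x = a then 1 else 0 := by
    intro x a hx ha
    have h := congrArg (primeFieldHom hp f) (sum_deltaCoeff (x : ZMod p) (a : ZMod p))
    simp only [ZMod.val_natCast_of_lt ha, ZMod.natCast_eq_natCast_iff', Nat.mod_eq_of_lt hx,
      Nat.mod_eq_of_lt ha] at h
    simpa [apply_ite (primeFieldHom hp f)] using h
  have factor : ∀ a b, ∑ k ∈ Finset.range p, ∑ l ∈ Finset.range p,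
      ((f a b * (deltaCoeff p a k * deltaCoeff p b l) : ℕ) : (primeFieldCode hp f).K) *
        (x : (primeFieldCode hp f).K) ^ k * (y : (primeFieldCode hp f).K) ^ l =
      (f a b : (primeFieldCode hp f).K) *
        ((∑ k ∈ Finset.range p, (deltaCoeff p a k : (primeFieldCode hp f).K) *
          (x : (primeFieldCode hp f).K) ^ k) *
        ∑ l ∈ Finset.range p, (deltaCoeff p b l : (primeFieldCode hp f).K) *
          (y : (primeFieldCode hp f).K) ^ l) := by
    intro a b
    rw [Finset.sum_mul_sum, Finset.mul_sum]
    refine Finset.sum_congr rfl fun k _ => ?_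
    rw [Finset.mul_sum]
    refine Finset.sum_congr rfl fun l _ => ?_
    push_cast
    ring
  show MvPolynomial.eval ![(x : (primeFieldCode hp f).K), (y : (primeFieldCode hp f).K)]
    (primeFieldCode hp f).poly = _
  rw [primeFieldCode_poly]
  simp only [map_sum, map_mul, map_pow, MvPolynomial.eval_C, MvPolynomial.eval_X,
    Matrix.cons_val_zero, Matrix.cons_val_one, factor]
  rw [Finset.sum_eq_single_of_mem x (Finset.mem_range.2 hx),
    Finset.sum_eq_single_of_mem y (Finset.mem_range.2 hy), delta hx hx, delta hy hy]
  · simp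
  · intro b hb hne
    rw [delta hy (Finset.mem_range.1 hb), if_neg hne.symm, mul_zero, mul_zero]
  · intro a ha hne
    refine Finset.sum_eq_zero fun b _ => ?_
    rw [delta hx (Finset.mem_range.1 ha), if_neg hne.symm, zero_mul, mul_zero]

variable {f}

theorem primeFieldCode_development (hf : ∀ x y, f x y < p) (i j : ℕ) :
    (primeFieldCode hp f).system.development i j =
      (numberSheet f i j : (primeFieldCode hp f).K) ∧ numberSheet f i j < p := by
  unfold numberSheet
  fun_induction recurrentSheet f (fun _ => 1) i j with
  | case1 j =>
    rw [DoubleRecursionSystem.development]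
    exact ⟨(Nat.cast_one (R := (primeFieldCode hp f).K)).symm, hp.one_lt⟩
  | case2 i =>
    rw [DoubleRecursionSystem.development]
    exact ⟨(Nat.cast_one (R := (primeFieldCode hp f).K)).symm, hp.one_lt⟩
  | case3 i j h₁ h₂ =>
    rw [DoubleRecursionSystem.development, h₁.1, h₂.1]
    exact ⟨primeFieldCode_eval hp f h₁.2 h₂.2, hf _ _⟩

theorem primeFieldCode_ultimatelyZero_iff (hf : ∀ x y, f x y < p) :
    (primeFieldCode hp f).system.UltimatelyZero ↔
      ∃ N, ∀ i j, 0 < i ∧ 0 < j ∧ i + j > N → numberSheet f i j = 0 := by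
  have h (i j : ℕ) : (primeFieldCode hp f).system.development i j =
      (primeFieldCode hp f).system.white ↔ numberSheet f i j = 0 := by
    have h := primeFieldCode_development hp hf i j
    rw [h.1]
    exact primeFieldCode_natCast_eq_zero hp f h.2
  simp only [DoubleRecursionSystem.UltimatelyZero, h]

end

/-! ### The reduction -/

theorem primrecPred_prime : PrimrecPred Nat.Prime := by
  have hdvd : PrimrecRel fun m p : ℕ => m ∣ p → m = 1 := by
    have h₁ : PrimrecRel fun m p : ℕ => ¬ p % m = 0 :=
      (Primrec.eq.comp (Primrec.nat_mod.comp Primrec.snd Primrec.fst) (Primrec.const 0)).not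
    have h₂ : PrimrecRel fun m _ : ℕ => m = 1 := Primrec.eq.comp Primrec.fst (Primrec.const 1)
    exact (PrimrecPred.or h₁ h₂).of_eq fun v => by
      simp only [Nat.dvd_iff_mod_eq_zero]; tauto
  have h : PrimrecPred fun p : ℕ => 2 ≤ p ∧ ∀ m < p, m ∣ p → m = 1 :=
    (Primrec.nat_le.comp (Primrec.const 2) Primrec.id).and
      (hdvd.forall_lt.comp Primrec.id Primrec.id)
  exact h.of_eq fun p => Nat.prime_def_lt.symm

/-- A prime number that is at least `n`. -/
def primeAbove (n : ℕ) : ℕ := Nat.findGreatest Nat.Prime (2 * (n + 1))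

theorem prime_primeAbove (n : ℕ) : (primeAbove n).Prime := by
  obtain ⟨p, hp, -, hle⟩ := Nat.exists_prime_lt_and_le_two_mul (n + 1) n.succ_ne_zero
  exact Nat.findGreatest_spec hle hp

theorem le_primeAbove (n : ℕ) : n ≤ primeAbove n := by
  obtain ⟨p, hp, hlt, hle⟩ := Nat.exists_prime_lt_and_le_two_mul (n + 1) n.succ_ne_zero
  exact (show n ≤ p by omega).trans (Nat.le_findGreatest hle hp)

theorem primrec_primeAbove : Primrec primeAbove :=
  Primrec.nat_findGreatest (Primrec.nat_double.comp Primrec.succ)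
    (primrecPred_prime.comp Primrec.snd)

/-- Already for symmetric polynomials over prime fields the question is undecidable: an algorithm
for it, applied to `primeFieldCode`, would solve the halting problem of a fixed machine. -/
theorem not_decidableOn_symmetric :
    ¬ DecidableOn (fun c : FieldSystemCode => c.IsPrimeField ∧ c.poly.IsSymmetric)
      (fun c : FieldSystemCode => c.system.UltimatelyZero) := by
  rintro ⟨alg, halg, hcorrect⟩
  obtain ⟨Γ, Λ, _, _, _, _, M, s, b₁, b₀, hundec⟩ := Turing.TM0.exists_undecidable_halting
  obtain ⟨Q, _, R, w, b, a, hR, hb, ha, hQ⟩ := Turing.TM0.exists_symmetric_rule M s b₁ b₀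
  obtain ⟨card, ⟨e⟩⟩ := Finite.exists_equiv_fin Q
  let _ : Primcodable Q := Primcodable.ofEquiv (Fin card) e
  obtain ⟨n, hn⟩ : ∃ n, ∀ q : Q, Encodable.encode q < n := by
    obtain ⟨n, hn⟩ := (Set.finite_range (Encodable.encode : Q → ℕ)).bddAbove
    exact ⟨n + 1, fun q => Nat.lt_succ_of_le (hn ⟨q, rfl⟩)⟩
  let p (m : ℕ) : ℕ := primeAbove (m + 5 + n)
  let f (m : ℕ) : ℕ → ℕ → ℕ := numberRule R w b a m
  have hp (m : ℕ) : (p m).Prime := prime_primeAbove _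
  have hlt (m x y : ℕ) : f m x y < p m := (numberRule_lt hn m x y).trans_le (le_primeAbove _)
  let code (m : ℕ) : FieldSystemCode := primeFieldCode (hp m) (f m)
  have hzero (m : ℕ) : (code m).system.UltimatelyZero ↔
      (Turing.TM0.eval M (s :: b₁ :: List.replicate (m + 1) b₀)).Dom := by
    rw [primeFieldCode_ultimatelyZero_iff (hp m) (hlt m),
      numberSheet_eventually_zero_iff hR hb ha, hQ]
  have hcode : Primrec fun m => (code m).1 := by
    have hpm : Primrec p := primrec_primeAbove.comp (Primrec.nat_add.comp
      (Primrec.nat_add.comp Primrec.id (Primrec.const 5)) (Primrec.const n))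
    exact hpm.pair ((Primrec.const [0, 1]).pair
      (primrec_interpolationTerms primrec_numberRule hpm))
  refine hundec ?_
  have halg' (m : ℕ) : ∃ r ∈ alg (code m).1,
      (r = true ↔ (Turing.TM0.eval M (s :: b₁ :: List.replicate (m + 1) b₀)).Dom) := by
    rw [← hzero]
    exact hcorrect (code m) ⟨primeFieldCode_isPrimeField _ _,
      primeFieldCode_isSymmetric _ _ (numberRule_symm hR m)⟩
  choose r hr hiff using halg'
  rw [ComputablePred.computable_iff]
  refine ⟨r, (halg.comp hcode.to_comp).of_eq fun m => Part.eq_some_iff.2 (hr m), ?_⟩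
  funext m
  exact propext (hiff m).symm

theorem corollary1p6 :
    ¬ DecidableOn (fun _ : FieldSystemCode => True)
      (fun c : FieldSystemCode => c.system.UltimatelyZero) ∧
    ¬ DecidableOn (fun c : FieldSystemCode => c.IsPrimeField ∧ c.poly.IsSymmetric)
      (fun c : FieldSystemCode => c.system.UltimatelyZero) := by
  refine ⟨fun ⟨alg, halg, h⟩ => ?_, not_decidableOn_symmetric⟩
  exact not_decidableOn_symmetric ⟨alg, halg, fun c _ => h c trivial⟩
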